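/- Let $R$ be an associative ring with unit and $M$ a left $R$-module. Write $N\le M$ for a submodule, and call it fully invariant if $f(N)\le N$ for all $f\in\operatorname{End}_R(M)$. Let $\sigma[M]$ be the full subcategory of $R$-modules isomorphic to submodules of $M$-generated modules (quotients of direct sums of copies of $M$). For $K,L\le M$ put $K_ML=\sum\{f(K)\mid f\in\operatorname{Hom}_R(M,L)\}$ and $\operatorname{Ann}_M(K)=\bigcap\{\operatorname{Ker} f\mid f\in\operatorname{Hom}_R(M,K)\}$. A proper fully invariant submodule $P$ of $M$ is *prime in $M$* if $K_ML\le P$ implies $K\le P$ or $L\le P$ for all fully invariant $K,L\le M$; $M$ is *semiprime* if $K_MK=0$ implies $K=0$ for all fully invariant $K\le M$; $M$ is a *duo module* if all its submodules are fully invariant. A module $N\in\sigma[M]$ is *$M$-singular* if there is an exact sequence $0\to K\to L\to N\to 0$ in $\sigma[M]$ with $K$ essential in $L$; $M$ is *non $M$-singular* if every homomorphism from an $M$-singular module to $M$ is zero. An *annihilator submodule* of $M$ is a submodule $\operatorname{Ann}_M(K)$ with $0\ne K\le M$; a *left annihilator* in $M$ is a submodule $\bigcap_{f\in X}\operatorname{Ker}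 f$ with $X\subseteq \operatorname{End}_R(M)$. A *pseudocomplement* in $M$ is a submodule that is, for some $N\le M$, maximal among the submodules $K\le M$ with $K\cap N=0$. $M$ has *finite uniform dimension* if some finite direct sum (possibly empty) of uniform submodules of $M$ is essential in $M$. **Proposition.** Let $M$ be projective in $\sigma[M]$, and suppose that $M$ is a semiprime and non $M$-singular duo module. The following conditions are equivalent: 1. $M$ has finite uniform dimension. 2. $M$ has a finite number of minimal prime submodules (minimal elements of the set of submodules prime in $M$). 3. The number of annihilators in $M$ is finite; here "annihilators" may be read as (a) annihilator submodules or (b) left annihilators. 4. $M$ satisfies the ascending chain condition on annihilators, read as (a) annihilator submodules or (b) left annihilators. 5. $M$ satisfies the ascending chain condition on pseudocomplements. That is, the seven conditions 1, 2, 3(a), 3(b), 4(a), 4(b), 5 are all equivalent. -/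

import Mathlib

namespace SigmaModule

universe u v

section Lattice

variable {R : Type u} [Ring R] {M : Type v} [AddCommGroup M] [Module R M]

/-- `N` is an essential submodule of the ambient module: it meets every nonzero submodule. -/
def IsEssential (N : Submodule R M) : Prop :=
  ∀ L : Submodule R M, N ⊓ L = ⊥ → L = ⊥

/-- `U` is a uniform submodule: it is nonzero and any two nonzero submodules of `U` meet. -/
def IsUniform (U : Submodule R M) : Prop :=
  U ≠ ⊥ ∧ ∀ A B : Submodule R M, A ≤ U → B ≤ U → A ⊓ B = ⊥ → A = ⊥ ∨ B = ⊥

variable (R M) in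
/-- Finite uniform dimension: some finite (internal) direct sum of uniform submodules is
essential in `M`. The empty sum is allowed, so the zero module has uniform dimension `0`. -/
def HasFiniteUniformDimension : Prop :=
  ∃ (n : ℕ) (U : Fin n → Submodule R M),
    (∀ i, IsUniform (U i)) ∧ iSupIndep U ∧ IsEssential (⨆ i, U i)

/-- `L` is a pseudocomplement of `N` in `M`: it is maximal among the submodules that intersect
`N` trivially. -/
def IsPseudocomplementOf (L N : Submodule R M) : Prop :=
  Maximal (fun K : Submodule R M => K ⊓ N = ⊥) L

variable (R M) in
/-- The set of all pseudocomplements in `M`. -/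
def pseudocomplements : Set (Submodule R M) :=
  {L | ∃ N : Submodule R M, IsPseudocomplementOf L N}

/-- The ascending chain condition on the members of a set of submodules. -/
def ACC (𝒜 : Set (Submodule R M)) : Prop :=
  ∀ a : ℕ → Submodule R M, Monotone a → (∀ n, a n ∈ 𝒜) → ∃ n, ∀ m, n ≤ m → a m = a n

end Lattice

section Sigma

variable (R : Type u) [Ring R] (M : Type v) [AddCommGroup M] [Module R M]

/-- `X` is `M`-generated: an epimorphic image of a direct sum of copies of `M`. -/
def IsGeneratedBy (X : Type v) [AddCommGroup X] [Module R X] : Prop :=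
  ∃ (ι : Type v) (f : (ι →₀ M) →ₗ[R] X), Function.Surjective f

/-- `X` belongs to `σ[M]`: it is isomorphic to a submodule of an `M`-generated module.

All modules are taken in the universe of `M`. Since every `X` in `σ[M]` is a directed union of
submodules of cardinality at most `max ℵ₀ |M|` this loses nothing, neither here nor
in the definitions of projectivity and singularity below. -/
def InSigma (X : Type v) [AddCommGroup X] [Module R X] : Prop :=
  ∃ (G : Type v) (_ : AddCommGroup G) (_ : Module R G),
    IsGeneratedBy R M G ∧ ∃ f : X →ₗ[R] G, Function.Injective f

/-- `M` is projective in `σ[M]`: homomorphisms from `M` lift along all epimorphisms of `σ[M]`. -/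
def IsProjectiveInSigma : Prop :=
  ∀ (L N : Type v) [AddCommGroup L] [Module R L] [AddCommGroup N] [Module R N],
    InSigma R M L → InSigma R M N →
      ∀ (g : L →ₗ[R] N) (f : M →ₗ[R] N), Function.Surjective g →
        ∃ h : M →ₗ[R] L, g ∘ₗ h = f

/-- `N` is `M`-singular: there is an exact sequence `0 → K → L → N → 0` in `σ[M]` with `K`
essential in `L`. (A submodule of a member of `σ[M]` is again in `σ[M]`, so `K` can be taken to
be the kernel of `L → N`.) -/
def IsSingular (N : Type v) [AddCommGroup N] [Module R N] : Prop :=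
  InSigma R M N ∧
    ∃ (L : Type v) (_ : AddCommGroup L) (_ : Module R L),
      InSigma R M L ∧
        ∃ g : L →ₗ[R] N, Function.Surjective g ∧ IsEssential (LinearMap.ker g)

/-- The largest `M`-singular submodule `𝒵(X) = ∑ {f(N) | N is M-singular, f ∈ Hom(N, X)}`. -/
def singularSubmodule (X : Type v) [AddCommGroup X] [Module R X] : Submodule R X :=
  sSup {Z | ∃ (N : Type v) (_ : AddCommGroup N) (_ : Module R N) (f : N →ₗ[R] X),
    IsSingular R M N ∧ Z = LinearMap.range f}

/-- `X` is non `M`-singular. -/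
def IsNonSingular (X : Type v) [AddCommGroup X] [Module R X] : Prop :=
  singularSubmodule R M X = ⊥

end Sigma

section Product

variable {R : Type u} [Ring R] {M : Type v} [AddCommGroup M] [Module R M]

/-- The product `K_M L = ∑ {f(K) | f ∈ Hom(M, L)}`. -/
def prod (K L : Submodule R M) : Submodule R M :=
  ⨆ f : M →ₗ[R] L, K.map (L.subtype ∘ₗ f)

/-- `Ann_M(K) = ⋂ {ker f | f ∈ Hom(M, K)}`. -/
def ann (K : Submodule R M) : Submodule R M :=
  ⨅ f : M →ₗ[R] K, LinearMap.ker f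

/-- A prime submodule: a proper fully invariant submodule `P` such that `K_M L ≤ P` implies
`K ≤ P` or `L ≤ P` for all fully invariant submodules `K`, `L`. -/
def IsPrimeSubmodule (P : Submodule R M) : Prop :=
  P ≠ ⊤ ∧ P.IsFullyInvariant ∧
    ∀ K L : Submodule R M, K.IsFullyInvariant → L.IsFullyInvariant →
      prod K L ≤ P → K ≤ P ∨ L ≤ P

/-- A semiprime submodule. -/
def IsSemiprimeSubmodule (N : Submodule R M) : Prop :=
  N.IsFullyInvariant ∧
    ∀ K : Submodule R M, K.IsFullyInvariant → prod K K ≤ N → K ≤ N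

variable (R M)

/-- `M` is a semiprime module: `0` is a semiprime submodule. -/
def IsSemiprimeModule : Prop :=
  IsSemiprimeSubmodule (⊥ : Submodule R M)

/-- `M` is a duo module: every submodule is fully invariant. -/
def IsDuo : Prop :=
  ∀ N : Submodule R M, N.IsFullyInvariant

/-- The set of minimal prime submodules of `M`. -/
def minimalPrimes : Set (Submodule R M) :=
  {P | Minimal IsPrimeSubmodule P}

/-- The set of annihilator submodules of `M`: those of the form `Ann_M(K)` with `0 ≠ K ≤ M`. -/
def annihilatorSubmodules : Set (Submodule R M) :=
  {N | ∃ K : Submodule R M, K ≠ ⊥ ∧ N = ann K}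

/-- The set of left annihilators in `M`: the submodules `⋂ {ker f | f ∈ X}`, `X ⊆ End(M)`. -/
def leftAnnihilators : Set (Submodule R M) :=
  {N | ∃ X : Set (Module.End R M), N = ⨅ f ∈ X, LinearMap.ker f}

end Product

end SigmaModule

namespace SigmaModule

universe u v

/-! ### Annihilators as pseudocomplements in the submodule lattice -/

section Product

variable {R : Type u} [Ring R] {M : Type v} [AddCommGroup M] [Module R M]

/-! In a semiprime duo module `prod K L` and `K ⊓ L` vanish together, so `ann K` is the largest
submodule meeting `K` trivially (`le_ann_iff`). Hence the pseudocomplements are exactly the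
submodules `ann K`. Projectivity gives the same for left annihilators (`ker_eq_ann_range`), and
annihilator submodules differ by at most `⊤`, so one set, `Set.range ann`, governs conditions 3, 4
and 5.

If a sum of finitely many uniform submodules is essential, their annihilators are primes with zero
intersection, so every minimal prime is one of them. Projectivity makes the minimal primes intersect
in zero; then `ann K` is the intersection of those not containing `K`, and finitely many minimal
primes leave finitely many annihilators, hence ACC. Under ACC, maximal annihilators yield uniform
submodules and then a finite family of them with essential sum. -/

theorem prod_le_iff {K L P : Submodule R M} :
    prod K L ≤ P ↔ ∀ f : M →ₗ[R] L, ∀ x ∈ K, (f x : M) ∈ P := by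
  simp only [prod, iSup_le_iff, Submodule.map_le_iff_le_comap]
  rfl

theorem apply_mem_prod {K L : Submodule R M} (f : M →ₗ[R] L) {x : M} (hx : x ∈ K) :
    (f x : M) ∈ prod K L :=
  prod_le_iff.1 le_rfl f x hx

theorem prod_mono {K K' L L' : Submodule R M} (hK : K ≤ K') (hL : L ≤ L') :
    prod K L ≤ prod K' L' :=
  prod_le_iff.2 fun f _ hx ↦ apply_mem_prod (Submodule.inclusion hL ∘ₗ f) (hK hx)

theorem prod_le_right (K L : Submodule R M) : prod K L ≤ L :=
  prod_le_iff.2 fun f x _ ↦ (f x).2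

theorem IsDuo.apply_mem (hduo : IsDuo R M) {K : Submodule R M} (f : Module.End R M) {x : M}
    (hx : x ∈ K) : f x ∈ K :=
  hduo K f hx

theorem IsDuo.prod_le_left (hduo : IsDuo R M) (K L : Submodule R M) : prod K L ≤ K :=
  prod_le_iff.2 fun f _ hx ↦ hduo.apply_mem (L.subtype ∘ₗ f) hx

theorem IsDuo.prod_le_inf (hduo : IsDuo R M) (K L : Submodule R M) : prod K L ≤ K ⊓ L :=
  le_inf (hduo.prod_le_left K L) (prod_le_right K L)

theorem mem_ann {K : Submodule R M} {x : M} : x ∈ ann K ↔ ∀ f : M →ₗ[R] K, f x = 0 := by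
  simp [ann]

theorem le_ann_iff_prod_eq_bot {K L : Submodule R M} : L ≤ ann K ↔ prod L K = ⊥ := by
  rw [eq_bot_iff, prod_le_iff]
  simp only [SetLike.le_def, mem_ann, Submodule.mem_bot, ZeroMemClass.coe_eq_zero]
  exact ⟨fun h f x hx ↦ h hx f, fun h x hx f ↦ h f x hx⟩

/-- In a semiprime duo module, a product vanishes exactly when the intersection does. -/
theorem prod_eq_bot_iff (hsemi : IsSemiprimeModule R M) (hduo : IsDuo R M)
    {K L : Submodule R M} : prod K L = ⊥ ↔ K ⊓ L = ⊥ := by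
  refine ⟨fun h ↦ ?_, fun h ↦ le_bot_iff.1 ((hduo.prod_le_inf K L).trans h.le)⟩
  exact le_bot_iff.1 (hsemi.2 _ (hduo _) ((prod_mono inf_le_left inf_le_right).trans h.le))

theorem le_ann_iff (hsemi : IsSemiprimeModule R M) (hduo : IsDuo R M) {K L : Submodule R M} :
    L ≤ ann K ↔ L ⊓ K = ⊥ :=
  le_ann_iff_prod_eq_bot.trans (prod_eq_bot_iff hsemi hduo)

theorem inf_ann_eq_bot (hsemi : IsSemiprimeModule R M) (hduo : IsDuo R M) (K : Submodule R M) :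
    K ⊓ ann K = ⊥ := by
  rw [inf_comm, ← le_ann_iff hsemi hduo]

theorem le_ann_comm (hsemi : IsSemiprimeModule R M) (hduo : IsDuo R M) {K L : Submodule R M} :
    L ≤ ann K ↔ K ≤ ann L := by
  rw [le_ann_iff hsemi hduo, le_ann_iff hsemi hduo, inf_comm]

theorem ann_antitone (hsemi : IsSemiprimeModule R M) (hduo : IsDuo R M) :
    Antitone (ann : Submodule R M → Submodule R M) := fun _ _ h ↦
  (le_ann_comm hsemi hduo).1 (h.trans ((le_ann_comm hsemi hduo).1 le_rfl))

theorem ann_iSup (hsemi : IsSemiprimeModule R M) (hduo : IsDuo R M) {ι : Sort*}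
    (K : ι → Submodule R M) : ann (⨆ i, K i) = ⨅ i, ann (K i) :=
  eq_of_forall_le_iff fun L ↦ by
    rw [le_ann_comm hsemi hduo, iSup_le_iff, le_iInf_iff]
    exact forall_congr' fun i ↦ le_ann_comm hsemi hduo

theorem ann_bot : ann (⊥ : Submodule R M) = ⊤ :=
  eq_top_iff.2 fun _ _ ↦ mem_ann.2 fun _ ↦ Subsingleton.elim _ _

theorem isEssential_iff_ann_eq_bot (hsemi : IsSemiprimeModule R M) (hduo : IsDuo R M)
    {N : Submodule R M} : IsEssential N ↔ ann N = ⊥ := by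
  refine ⟨fun h ↦ h _ (inf_ann_eq_bot hsemi hduo N), fun h L hL ↦ ?_⟩
  rw [inf_comm, ← le_ann_iff hsemi hduo, h] at hL
  exact le_bot_iff.1 hL

theorem isPseudocomplementOf_iff (hsemi : IsSemiprimeModule R M) (hduo : IsDuo R M)
    {K N : Submodule R M} : IsPseudocomplementOf K N ↔ K = ann N := by
  have h : (fun K : Submodule R M ↦ K ⊓ N = ⊥) = (· ∈ Set.Iic (ann N)) :=
    funext fun K ↦ propext (le_ann_iff hsemi hduo).symm
  rw [IsPseudocomplementOf, h]
  exact ⟨fun hK ↦ hK.eq_of_le Set.self_mem_Iic hK.prop,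
    fun hK ↦ hK ▸ ⟨Set.self_mem_Iic, fun _ hL _ ↦ hK ▸ hL⟩⟩

theorem pseudocomplements_eq_range_ann (hsemi : IsSemiprimeModule R M) (hduo : IsDuo R M) :
    pseudocomplements R M = Set.range ann := by
  ext K
  simp only [pseudocomplements, Set.mem_ofPred_eq, isPseudocomplementOf_iff hsemi hduo,
    Set.mem_range, eq_comm]

/-- Allowing `K = ⊥` adds at most `⊤`, which affects neither finiteness nor ACC. -/
theorem range_ann_eq_insert :
    Set.range (ann : Submodule R M → Submodule R M) = insert ⊤ (annihilatorSubmodules R M) := by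
  ext N
  constructor
  · rintro ⟨K, rfl⟩
    rcases eq_or_ne K ⊥ with rfl | hK
    · exact Or.inl ann_bot
    · exact Or.inr ⟨K, hK, rfl⟩
  · rintro (rfl | ⟨K, -, rfl⟩)
    · exact ⟨⊥, ann_bot⟩
    · exact ⟨K, rfl⟩

/-! ### Chain conditions and uniform submodules -/

theorem ACC.insert_top {𝒜 : Set (Submodule R M)} (h : ACC 𝒜) : ACC (insert ⊤ 𝒜) := by
  intro a ha hmem
  by_cases htop : ∃ n, a n = ⊤
  · obtain ⟨n, hn⟩ := htop
    exact ⟨n, fun m hm ↦ by rw [hn, eq_top_iff, ← hn]; exact ha hm⟩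
  · exact h a ha fun n ↦ (hmem n).resolve_left fun hn ↦ htop ⟨n, hn⟩

theorem ACC.exists_maximal {𝒜 : Set (Submodule R M)} (h : ACC 𝒜) {𝒮 : Set (Submodule R M)}
    (h𝒮 : 𝒮 ⊆ 𝒜) (hne : 𝒮.Nonempty) : ∃ N, Maximal (· ∈ 𝒮) N := by
  have : WellFoundedGT 𝒮 := wellFoundedGT_iff_monotone_chain_condition.2 fun a ↦
    (h (fun n ↦ a n) (fun _ _ hmn ↦ a.monotone hmn) fun n ↦ h𝒮 (a n).2).imp
      fun n hn m hm ↦ Subtype.ext (hn m hm).symm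
  have : Nonempty 𝒮 := hne.to_subtype
  obtain ⟨N, -, hN⟩ := WellFounded.has_min (wellFounded_gt : WellFounded ((· > ·) : 𝒮 → 𝒮 → Prop))
    Set.univ Set.univ_nonempty
  exact ⟨N, N.2, fun K hK hNK ↦ by
    by_contra hlt
    exact hN ⟨K, hK⟩ trivial (lt_of_le_not_ge hNK hlt)⟩

theorem acc_of_finite {𝒜 : Set (Submodule R M)} (h : 𝒜.Finite) : ACC 𝒜 := by
  intro a ha hmem
  have : Finite 𝒜 := h
  obtain ⟨n, hn⟩ := WellFoundedGT.monotone_chain_condition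
    (⟨fun n ↦ ⟨a n, hmem n⟩, fun _ _ hmn ↦ ha hmn⟩ : ℕ →o 𝒜)
  exact ⟨n, fun m hm ↦ (congrArg Subtype.val (hn m hm)).symm⟩

/-- If annihilators satisfy the ascending chain condition, nonzero submodules contain
uniform ones. -/
theorem exists_isUniform_le (hsemi : IsSemiprimeModule R M) (hduo : IsDuo R M)
    (hacc : ACC (Set.range (ann : Submodule R M → Submodule R M))) {N : Submodule R M}
    (hN : N ≠ ⊥) : ∃ U ≤ N, IsUniform U := by
  -- With `ann K` maximal, a nonzero `A ≤ K` has `ann A = ann K`; so any `B ≤ K` disjoint from `A`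
  -- lies in `K ⊓ ann K = ⊥`.
  obtain ⟨_, ⟨K, ⟨hK, hKN⟩, rfl⟩, hmax⟩ := hacc.exists_maximal
    (𝒮 := ann '' {K | K ≠ ⊥ ∧ K ≤ N}) (Set.image_subset_range _ _) ⟨_, N, ⟨hN, le_rfl⟩, rfl⟩
  refine ⟨K, hKN, hK, fun A B hA hB hAB ↦ or_iff_not_imp_left.2 fun hA0 ↦ ?_⟩
  have h1 : B ≤ ann K := ((le_ann_iff hsemi hduo).2 ((inf_comm B A).trans hAB)).trans
    (hmax ⟨A, ⟨hA0, hA.trans hKN⟩, rfl⟩ (ann_antitone hsemi hduo hA))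
  exact le_bot_iff.1 ((le_inf hB h1).trans (inf_ann_eq_bot hsemi hduo K).le)

theorem hasFiniteUniformDimension_of_acc (hsemi : IsSemiprimeModule R M) (hduo : IsDuo R M)
    (hacc : ACC (Set.range (ann : Submodule R M → Submodule R M))) :
    HasFiniteUniformDimension R M := by
  classical
  let 𝒮 : Set (Finset (Submodule R M)) :=
    {s | (∀ U ∈ s, IsUniform U) ∧ (s : Set (Submodule R M)).Pairwise (· ≤ ann ·)}
  -- The double annihilator grows with `s` and is itself an annihilator, so ACC gives a maximal one.
  -- A uniform submodule inside `ann (s.sup id)` would enlarge it.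
  obtain ⟨_, ⟨s, ⟨hs, hpair⟩, rfl⟩, hmax⟩ := hacc.exists_maximal
    (𝒮 := (fun s ↦ ann (ann (s.sup id))) '' 𝒮)
    (Set.image_subset_iff.2 fun s _ ↦ ⟨_, rfl⟩) ⟨_, ∅, by simp [𝒮], rfl⟩
  have hess : ann (s.sup id) = ⊥ := by
    by_contra hne
    obtain ⟨U, hU, hunif⟩ := exists_isUniform_le hsemi hduo hacc hne
    have hsU : ∀ V ∈ s, V ≤ ann U := fun V hV ↦
      (Finset.le_sup (f := id) hV).trans ((le_ann_comm hsemi hduo).1 hU)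
    have hins : insert U s ∈ 𝒮 := by
      refine ⟨Finset.forall_mem_insert _ _ _ |>.2 ⟨hunif, hs⟩, ?_⟩
      rw [Finset.coe_insert]
      exact hpair.insert fun V hV _ ↦ ⟨(le_ann_comm hsemi hduo).1 (hsU V hV), hsU V hV⟩
    have hle := hmax ⟨_, hins, rfl⟩ (ann_antitone hsemi hduo
      (ann_antitone hsemi hduo (Finset.sup_mono (Finset.subset_insert U s))))
    have hU' : U ≤ ann (ann (s.sup id)) := by
      refine le_trans ?_ hle
      exact ((Finset.le_sup (f := id) (Finset.mem_insert_self U s))).trans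
        ((le_ann_comm hsemi hduo).1 le_rfl)
    exact hunif.1 (le_bot_iff.1 ((le_inf hU hU').trans (inf_ann_eq_bot hsemi hduo _).le))
  refine ⟨s.card, fun i ↦ s.equivFin.symm i, fun i ↦ hs _ (s.equivFin.symm i).2, fun i ↦ ?_, ?_⟩
  -- Pairwise disjointness already gives independence, because `ann` turns sums into intersections.
  · rw [disjoint_iff, ← le_ann_iff hsemi hduo, le_ann_comm hsemi hduo, iSup₂_le_iff]
    intro j hj
    exact hpair (s.equivFin.symm j).2 (s.equivFin.symm i).2 fun h ↦
      hj (s.equivFin.symm.injective (Subtype.ext h))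
  · rw [isEssential_iff_ann_eq_bot hsemi hduo, ← hess]
    congr 1
    rw [Finset.sup_eq_iSup, iSup_subtype', ← s.equivFin.symm.iSup_comp]
    rfl

/-! ### Prime submodules -/

theorem isPrimeSubmodule_ann_of_isUniform (hsemi : IsSemiprimeModule R M) (hduo : IsDuo R M)
    {U : Submodule R M} (hU : IsUniform U) : IsPrimeSubmodule (ann U) := by
  refine ⟨fun h ↦ hU.1 ?_, hduo _, fun K L _ _ hKL ↦ ?_⟩
  · simpa [h] using inf_ann_eq_bot hsemi hduo U
  · by_contra! hcon
    rw [le_ann_iff hsemi hduo, le_ann_iff hsemi hduo] at hcon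
    -- If neither `K` nor `L` lies in `ann U`, both meet `U`, and uniformity makes the two traces
    -- meet. Yet the product of the traces lies in `U ⊓ ann U`.
    have hne : (K ⊓ U) ⊓ (L ⊓ U) ≠ ⊥ := fun h ↦
      (hU.2 _ _ inf_le_right inf_le_right h).elim hcon.1 hcon.2
    refine hne ?_
    rw [← prod_eq_bot_iff hsemi hduo]
    refine le_bot_iff.1 (le_trans (le_inf ?_ ?_) (inf_ann_eq_bot hsemi hduo U).le)
    · exact (prod_le_right _ _).trans inf_le_right
    · exact (prod_mono inf_le_left inf_le_left).trans hKL

theorem IsPrimeSubmodule.le_or_le_of_inf_le (hduo : IsDuo R M) {P K L : Submodule R M}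
    (hP : IsPrimeSubmodule P) (h : K ⊓ L ≤ P) : K ≤ P ∨ L ≤ P :=
  hP.2.2 K L (hduo K) (hduo L) ((hduo.prod_le_inf K L).trans h)

theorem IsPrimeSubmodule.exists_le_of_finset_inf_le (hduo : IsDuo R M) {P : Submodule R M}
    (hP : IsPrimeSubmodule P) {ι : Type*} (s : Finset ι) (K : ι → Submodule R M)
    (h : s.inf K ≤ P) : ∃ i ∈ s, K i ≤ P := by
  classical
  induction s using Finset.induction_on with
  | empty => exact absurd (top_le_iff.1 (by simpa using h)) hP.1
  | insert i s _ ih =>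
    rw [Finset.inf_insert] at h
    rcases hP.le_or_le_of_inf_le hduo h with h | h
    · exact ⟨i, Finset.mem_insert_self i s, h⟩
    · obtain ⟨j, hj, hle⟩ := ih h
      exact ⟨j, Finset.mem_insert_of_mem hj, hle⟩

theorem finite_minimalPrimes (hsemi : IsSemiprimeModule R M) (hduo : IsDuo R M)
    (h : HasFiniteUniformDimension R M) : (minimalPrimes R M).Finite := by
  obtain ⟨n, U, hU, -, hess⟩ := h
  rw [isEssential_iff_ann_eq_bot hsemi hduo, ann_iSup hsemi hduo] at hess
  refine (Set.finite_range fun i ↦ ann (U i)).subset fun P hP ↦ ?_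
  obtain ⟨i, -, hi⟩ := hP.1.exists_le_of_finset_inf_le hduo Finset.univ (fun i ↦ ann (U i))
    (by rw [Finset.inf_univ_eq_iInf, hess]; exact bot_le)
  exact ⟨i, hi.antisymm (hP.2 (isPrimeSubmodule_ann_of_isUniform hsemi hduo (hU i)) hi)⟩

/-- The intersection of a nonempty chain of prime submodules of a duo module is prime. -/
theorem isPrimeSubmodule_sInf_of_isChain (hduo : IsDuo R M) {c : Set (Submodule R M)}
    (hc : ∀ P ∈ c, IsPrimeSubmodule P) (hchain : IsChain (· ≤ ·) c) (hne : c.Nonempty) :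
    IsPrimeSubmodule (sInf c) := by
  obtain ⟨P, hP⟩ := hne
  refine ⟨fun h ↦ (hc P hP).1 (top_le_iff.1 (h ▸ sInf_le hP)), hduo _, fun K L hK hL hKL ↦ ?_⟩
  by_contra! hcon
  simp only [le_sInf_iff, not_forall] at hcon
  obtain ⟨⟨P, hP, hKP⟩, ⟨Q, hQ, hLQ⟩⟩ := hcon
  rcases hchain.total hP hQ with h | h
  · rcases (hc P hP).2.2 K L hK hL (hKL.trans (sInf_le hP)) with h' | h'
    exacts [hKP h', hLQ (h'.trans h)]
  · rcases (hc Q hQ).2.2 K L hK hL (hKL.trans (sInf_le hQ)) with h' | h'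
    exacts [hKP (h'.trans h), hLQ h']

theorem exists_minimalPrime_le (hduo : IsDuo R M) {P : Submodule R M} (hP : IsPrimeSubmodule P) :
    ∃ Q ∈ minimalPrimes R M, Q ≤ P := by
  obtain ⟨Q, hQP, hQ⟩ := zorn_le_nonempty₀ (α := (Submodule R M)ᵒᵈ)
    {Q | IsPrimeSubmodule (OrderDual.ofDual Q)} (fun c hc hchain y hy ↦
      ⟨OrderDual.toDual (sInf (OrderDual.toDual ⁻¹' c)),
        isPrimeSubmodule_sInf_of_isChain hduo hc hchain.symm ⟨y, hy⟩,
        fun z hz ↦ sInf_le (α := Submodule R M) hz⟩) (OrderDual.toDual P) hP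
  exact ⟨OrderDual.ofDual Q, ⟨hQ.1, fun K hK hle ↦ hQ.2 (y := OrderDual.toDual K) hK hle⟩, hQP⟩

end Product

/-! ### Consequences of projectivity -/

section Projective

variable {R : Type u} [Ring R] {M : Type v} [AddCommGroup M] [Module R M]

theorem inSigma_of_injective {X : Type v} [AddCommGroup X] [Module R X] (f : X →ₗ[R] M × M)
    (hf : Function.Injective f) : InSigma R M X := by
  -- `ULift` puts the two-element index type in the universe of `M`.
  refine ⟨M × M, inferInstance, inferInstance, ⟨ULift Bool,
    (Finsupp.lapply ⟨true⟩).prod (Finsupp.lapply ⟨false⟩), fun x ↦ ?_⟩, f, hf⟩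
  exact ⟨Finsupp.single ⟨true⟩ x.1 + Finsupp.single ⟨false⟩ x.2, by simp⟩

theorem inSigma_submodule (N : Submodule R M) : InSigma R M N :=
  inSigma_of_injective (LinearMap.inl R M M ∘ₗ N.subtype)
    (LinearMap.inl_injective.comp N.subtype_injective)

/-- Lift `f` along the addition map from `A × B` onto `A ⊔ B`. -/
theorem IsProjectiveInSigma.exists_add_eq (hproj : IsProjectiveInSigma R M)
    {A B : Submodule R M} (f : M →ₗ[R] (A ⊔ B : Submodule R M)) :
    ∃ (g : M →ₗ[R] A) (h : M →ₗ[R] B), ∀ x, (f x : M) = g x + h x := by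
  have hmem : ∀ x : A × B, A.subtype.coprod B.subtype x ∈ A ⊔ B := fun x ↦
    Submodule.add_mem_sup x.1.2 x.2.2
  obtain ⟨k, hk⟩ := hproj (A × B) (A ⊔ B : Submodule R M)
    (inSigma_of_injective (A.subtype.prodMap B.subtype)
      (Prod.map_injective.2 ⟨A.subtype_injective, B.subtype_injective⟩))
    (inSigma_submodule _) ((A.subtype.coprod B.subtype).codRestrict _ hmem) f (by
      rintro ⟨x, hx⟩
      obtain ⟨a, ha, b, hb, rfl⟩ := Submodule.mem_sup.1 hx
      exact ⟨(⟨a, ha⟩, ⟨b, hb⟩), rfl⟩)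
  refine ⟨LinearMap.fst R A B ∘ₗ k, LinearMap.snd R A B ∘ₗ k, fun x ↦ ?_⟩
  rw [← hk]
  rfl

/-- By projectivity every map from `M` to the range of `f` factors as `f ∘ h`, and `h` preserves
`ker f` since `M` is duo. -/
theorem ker_eq_ann_range (hproj : IsProjectiveInSigma R M) (hduo : IsDuo R M)
    (f : Module.End R M) :
    LinearMap.ker f = ann (LinearMap.range f) := by
  refine le_antisymm ?_ fun x hx ↦ ?_
  · rw [le_ann_iff_prod_eq_bot, eq_bot_iff, prod_le_iff]
    intro g x hx
    obtain ⟨h, rfl⟩ := hproj M (LinearMap.range f)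
      (inSigma_of_injective (LinearMap.inl R M M) LinearMap.inl_injective)
      (inSigma_submodule _) f.rangeRestrict g f.surjective_rangeRestrict
    exact hduo.apply_mem h hx
  · exact congrArg Subtype.val (mem_ann.1 hx f.rangeRestrict)

theorem leftAnnihilators_eq_range_ann (hproj : IsProjectiveInSigma R M)
    (hsemi : IsSemiprimeModule R M) (hduo : IsDuo R M) :
    leftAnnihilators R M = Set.range ann := by
  ext N
  constructor
  · rintro ⟨X, rfl⟩
    refine ⟨⨆ f : X, LinearMap.range f.1, ?_⟩
    simp only [ann_iSup hsemi hduo, ← ker_eq_ann_range hproj hduo, iInf_subtype]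
  · rintro ⟨K, rfl⟩
    refine ⟨Set.range fun f : M →ₗ[R] K ↦ K.subtype ∘ₗ f, ?_⟩
    rw [iInf_range]
    exact iInf_congr fun f ↦ (LinearMap.ker_comp_of_ker_eq_bot _ K.ker_subtype).symm

/-- Allows primeness of `P` to be tested on submodules containing `P`, where maximality of `P` can
be used. -/
theorem prod_sup_sup_le (hproj : IsProjectiveInSigma R M) (hduo : IsDuo R M)
    {K L P : Submodule R M} (h : prod K L ≤ P) : prod (K ⊔ P) (L ⊔ P) ≤ P := by
  refine prod_le_iff.2 fun f x hx ↦ ?_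
  obtain ⟨k, hk, p, hp, rfl⟩ := Submodule.mem_sup.1 hx
  obtain ⟨g, q, hgq⟩ := hproj.exists_add_eq f
  rw [map_add, Submodule.coe_add, hgq k]
  exact add_mem (add_mem (h (apply_mem_prod g hk)) (q k).2)
    (hduo.apply_mem ((L ⊔ P).subtype ∘ₗ f) hp)

/-- In a semiprime duo module that is projective in `σ[M]`, every nonzero element is avoided by
some prime submodule. -/
theorem exists_isPrimeSubmodule_notMem (hproj : IsProjectiveInSigma R M)
    (hsemi : IsSemiprimeModule R M) (hduo : IsDuo R M) {x : M} (hx : x ≠ 0) :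
    ∃ P : Submodule R M, IsPrimeSubmodule P ∧ x ∉ P := by
  -- Analogue of an m-sequence: from `x`, pick each next nonzero term in the square of the cyclic
  -- submodule of the last. A submodule maximal among those missing every term will be prime.
  have hstep : ∀ y : {y : M // y ≠ 0}, ∃ z : {z : M // z ≠ 0},
      (z : M) ∈ prod (R ∙ (y : M)) (R ∙ (y : M)) := by
    rintro ⟨y, hy⟩
    have : prod (R ∙ y) (R ∙ y) ≠ ⊥ := fun h ↦ hy <| by
      simpa using hsemi.2 _ (hduo (R ∙ y)) h.le
    obtain ⟨z, hz, hz0⟩ := Submodule.exists_mem_ne_zero_of_ne_bot this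
    exact ⟨⟨z, hz0⟩, hz⟩
  choose next hnext using hstep
  let a : ℕ → {y : M // y ≠ 0} := fun n ↦ next^[n] ⟨x, hx⟩
  have ha : ∀ n, (a (n + 1) : M) ∈ prod (R ∙ (a n : M)) (R ∙ (a n : M)) := fun n ↦ by
    simp only [a, Function.iterate_succ_apply']
    exact hnext _
  have hanti : Antitone fun n ↦ R ∙ (a n : M) := antitone_nat_of_succ_le fun n ↦
    (Submodule.span_singleton_le_iff_mem _ _).2 (prod_le_right _ _ (ha n))
  obtain ⟨P, -, hP, hmax⟩ := zorn_le_nonempty₀ {P : Submodule R M | ∀ n, (a n : M) ∉ P}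
    (fun c hc hchain Q hQ ↦ ⟨sSup c, fun n hn ↦ by
      obtain ⟨N, hN, hnN⟩ := (Submodule.mem_sSup_of_directed ⟨Q, hQ⟩ hchain.directedOn).1 hn
      exact hc hN n hnN, fun _ ↦ le_sSup⟩)
    ⊥ (fun n hn ↦ (a n).2 ((Submodule.mem_bot R).1 hn))
  have hlarge : ∀ K : Submodule R M, ¬ K ≤ P → ∃ n, (R ∙ (a n : M)) ≤ K ⊔ P := fun K hK ↦ by
    by_contra! hcon
    exact hK (le_sup_left.trans (hmax (y := K ⊔ P)
      (fun n hn ↦ hcon n ((Submodule.span_singleton_le_iff_mem _ _).2 hn)) le_sup_right))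
  refine ⟨P, ⟨fun h ↦ hP 0 (h ▸ Submodule.mem_top), hduo P, fun K L _ _ hKL ↦ ?_⟩, hP 0⟩
  by_contra! hcon
  obtain ⟨m, hm⟩ := hlarge K hcon.1
  obtain ⟨n, hn⟩ := hlarge L hcon.2
  -- Both enlarged submodules contain the term of index `max m n`, so their product contains the
  -- next one.
  exact hP (max m n + 1) (prod_sup_sup_le hproj hduo hKL
    (prod_mono ((hanti (le_max_left m n)).trans hm) ((hanti (le_max_right m n)).trans hn)
      (ha (max m n))))

theorem sInf_minimalPrimes (hproj : IsProjectiveInSigma R M)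
    (hsemi : IsSemiprimeModule R M) (hduo : IsDuo R M) : sInf (minimalPrimes R M) = ⊥ := by
  refine eq_bot_iff.2 fun x hx ↦ ?_
  by_contra hx0
  obtain ⟨P, hP, hxP⟩ := exists_isPrimeSubmodule_notMem hproj hsemi hduo hx0
  obtain ⟨Q, hQ, hQP⟩ := exists_minimalPrime_le hduo hP
  exact hxP (hQP ((Submodule.mem_sInf).1 hx Q hQ))

theorem ann_eq_sInf_minimalPrimes (hproj : IsProjectiveInSigma R M)
    (hsemi : IsSemiprimeModule R M) (hduo : IsDuo R M) (K : Submodule R M) :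
    ann K = sInf {P ∈ minimalPrimes R M | ¬ K ≤ P} := by
  refine le_antisymm (le_sInf fun P hP ↦ ?_) ?_
  -- A prime contains `K ⊓ ann K = ⊥`, hence contains `K` or `ann K`.
  · exact (hP.1.1.le_or_le_of_inf_le hduo
      ((inf_ann_eq_bot hsemi hduo K).le.trans bot_le)).resolve_left hP.2
  · rw [le_ann_iff hsemi hduo, eq_bot_iff, ← sInf_minimalPrimes hproj hsemi hduo]
    refine le_sInf fun P hP ↦ ?_
    by_cases hKP : K ≤ P
    · exact inf_le_right.trans hKP
    · exact inf_le_left.trans (sInf_le ⟨hP, hKP⟩)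

theorem finite_range_ann (hproj : IsProjectiveInSigma R M)
    (hsemi : IsSemiprimeModule R M) (hduo : IsDuo R M) (h : (minimalPrimes R M).Finite) :
    (Set.range (ann : Submodule R M → Submodule R M)).Finite := by
  refine (h.finite_subsets.image sInf).subset ?_
  rintro _ ⟨K, rfl⟩
  exact ⟨_, Set.sep_subset _ _, (ann_eq_sInf_minimalPrimes hproj hsemi hduo K).symm⟩

end Projective

end SigmaModule

theorem proposition3p5 {R : Type*} [Ring R] {M : Type*} [AddCommGroup M] [Module R M]
    (hproj : SigmaModule.IsProjectiveInSigma R M)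
    (hsemi : SigmaModule.IsSemiprimeModule R M)
    (hsing : SigmaModule.IsNonSingular R M M)
    (hduo : SigmaModule.IsDuo R M) :
    List.TFAE [
      SigmaModule.HasFiniteUniformDimension R M,
      (SigmaModule.minimalPrimes R M).Finite,
      (SigmaModule.annihilatorSubmodules R M).Finite,
      (SigmaModule.leftAnnihilators R M).Finite,
      SigmaModule.ACC (SigmaModule.annihilatorSubmodules R M),
      SigmaModule.ACC (SigmaModule.leftAnnihilators R M),
      SigmaModule.ACC (SigmaModule.pseudocomplements R M)] := by
  have hann := SigmaModule.range_ann_eq_insert (R := R) (M := M)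
  rw [SigmaModule.leftAnnihilators_eq_range_ann hproj hsemi hduo,
    SigmaModule.pseudocomplements_eq_range_ann hsemi hduo]
  tfae_have 1 → 2 := SigmaModule.finite_minimalPrimes hsemi hduo
  tfae_have 2 → 4 := SigmaModule.finite_range_ann hproj hsemi hduo
  tfae_have 4 → 3 := fun h ↦ h.subset (hann ▸ Set.subset_insert _ _)
  tfae_have 3 → 5 := SigmaModule.acc_of_finite
  tfae_have 5 → 6 := fun h ↦ hann ▸ h.insert_top
  tfae_have 6 → 7 := id
  tfae_have 7 → 1 := SigmaModule.hasFiniteUniformDimension_of_acc hsemi hduo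
  tfae_finish
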